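/- **Theorem 2.8.** Let $(A,\|\cdot\|)$ be a commutative complex Banach algebra, with or without a unit, which is - *semisimple*, i.e. its Jacobson radical is $\{0\}$, and - *regular*, i.e. writing $M(A,\|\cdot\|)$ for the set of nonzero $\|\cdot\|$-continuous multiplicative linear functionals on $A$, endowed with the weak-* topology, for every closed set $F\subset M(A,\|\cdot\|)$ and every $f\in M(A,\|\cdot\|)\setminus F$ there is $x\in A$ with $g(x)=0$ for all $g\in F$ and $f(x)\neq 0$. Let $|\cdot|$ be any algebra norm on $A$, i.e. a vector space norm with $|xy|\le |x||y|$ for all $x,y\in A$ (neither completeness of $|\cdot|$ nor any relation between $|\cdot|$ and $\|\cdot\|$ is assumed). Then $|\cdot|$ is a *Q-algebra norm* on $A$, i.e. the set of quasi-invertible elements of $A$ is open in the topology defined by $|\cdot|$. Moreover the character spaces for the two norms coincide, $M(A,|\cdot|)=M(A,\|\cdot\|)$, and $r_A(x)\le |x|$ for all $x\in A$, where $r_A(x)$ is the spectral radius of $x$ in $A$ (computed in the unitization of $A$ if $A$ has no unit). -/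

import Mathlib

open scoped ENNReal NNReal

/-- An algebra norm on a complex algebra `A`, which need not have a unit: a submultiplicative
vector space norm. -/
structure NonUnitalAlgebraNorm (A : Type*) [NonUnitalRing A] [Module ℂ A] extends
  RingNorm A, Seminorm ℂ A

namespace NonUnitalAlgebraNorm

variable {A : Type*} [NonUnitalRing A] [Module ℂ A]

instance : CoeFun (NonUnitalAlgebraNorm A) (fun _ => A → ℝ) := ⟨fun N => N.toFun⟩

/-- The topology on `A` of the metric `(x, y) ↦ N (x - y)`. -/
@[reducible]
def topology (N : NonUnitalAlgebraNorm A) : TopologicalSpace A :=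
  (AddGroupNorm.toNormedAddCommGroup N.toAddGroupNorm).toPseudoMetricSpace.toUniformSpace.toTopologicalSpace

end NonUnitalAlgebraNorm

/-- The set of quasi-invertible elements is open. Mathlib's `IsQuasiregular x` says that `1 + x` is
invertible in the unitization; the other usual convention asks this of `1 - x`, which replaces the
set by its negative and hence gives the same notion of a Q-algebra. -/
def IsQAlgebra (A : Type*) [NonUnitalRing A] [TopologicalSpace A] : Prop :=
  IsOpen {x : A | IsQuasiregular x}

/-- `N` is a Q-algebra norm: `(A, N)` is a normed Q-algebra. -/
def NonUnitalAlgebraNorm.IsQAlgebraNorm {A : Type*} [NonUnitalRing A] [Module ℂ A]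
    (N : NonUnitalAlgebraNorm A) : Prop :=
  @IsQAlgebra A _ N.topology

/-- Regularity: Gelfand transforms separate points of the space of nonzero continuous characters
(with the weak-* topology) from closed subsets of it. -/
def IsRegularAlgebra (A : Type*) [NonUnitalRing A] [Module ℂ A] [TopologicalSpace A] : Prop :=
  ∀ F : Set (WeakDual.characterSpace ℂ A), IsClosed F →
    ∀ f : WeakDual.characterSpace ℂ A, f ∉ F →
      ∃ x : A, (∀ g ∈ F, g x = 0) ∧ f x ≠ 0

/-- The Jacobson radical of a commutative ring without assumed unit: the elements `x` all of whose
multiples `a * x` are quasi-invertible. -/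
def commJacobsonRadical (A : Type*) [NonUnitalCommRing A] : Set A :=
  {x | ∀ a : A, IsQuasiregular (a * x)}

/-- A commutative algebra is semisimple if its Jacobson radical is zero. -/
def IsSemisimpleAlgebra (A : Type*) [NonUnitalCommRing A] : Prop :=
  commJacobsonRadical A = {0}

/-- The space `M(A)` of nonzero continuous characters, viewed as a subset of `A → ℂ`, so that the
character spaces of one algebra for two topologies can be compared. (The weak-* topology of `M(A)`
is the one induced by the product topology of `A → ℂ`, so nothing is lost.) -/
def characters (A : Type*) [NonUnitalRing A] [Module ℂ A] [TopologicalSpace A] : Set (A → ℂ) :=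
  Set.range (fun φ : WeakDual.characterSpace ℂ A => (φ : A → ℂ))

/-- The space `M(A, N)` of nonzero characters of `A` that are continuous for the norm `N`. -/
def NonUnitalAlgebraNorm.characters {A : Type*} [NonUnitalRing A] [Module ℂ A]
    (N : NonUnitalAlgebraNorm A) : Set (A → ℂ) :=
  @_root_.characters A _ _ N.topology

/-- The spectral radius `r_A(x)` in an algebra without assumed unit, as the supremum of `|k|` over
the quasispectrum (which is the spectrum of `x` in the unitization, and is `sp_A(x) ∪ {0}` when `A`
has a unit). -/
noncomputable def nonUnitalSpectralRadius {A : Type*} [NonUnitalRing A] [Module ℂ A] (x : A) :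
    ℝ≥0∞ :=
  ⨆ k ∈ quasispectrum ℂ x, (‖k‖₊ : ℝ≥0∞)

open Metric

/-! All three claims follow from `‖f x‖ ≤ N x` for every character `f`. Suppose `f` lies outside the
weak-* closed set `E` of characters bounded by `N`. Regularity gives `a` vanishing on `E`, scaled so
that `f a = 1`, and `v` with `f v ≠ 0` whose transform is supported where that of `a` is near `1`.
If `u` has transform `1` there and `0` where that of `a` vanishes, semisimplicity gives `u * v = v`.
Every `N`-contractive functional kills `u`, so `1 - u` is invertible in the completed unitization
for `N`, and `v = 0`, a contradiction.

The element `u` comes from a Riesz idempotent, a Cauchy integral of the resolvent, in a quotient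
where the spectrum of `a` is disconnected. -/

/-- In a commutative complex Banach algebra, if the circle `C(c, r)` avoids the spectrum of `x`,
then some element takes, under each character `φ`, the value `1` when `φ x` lies inside the circle
and `0` when `φ x` lies outside. -/
theorem exists_forall_algHom_apply_eq_indicator {R : Type*} [NormedCommRing R] [NormedAlgebra ℂ R]
    [CompleteSpace R] {x : R} {c : ℂ} {r : ℝ} (hr : 0 ≤ r)
    (hx : ∀ z ∈ spectrum ℂ x, z ∉ sphere c r) :
    ∃ e : R, ∀ φ : R →ₐ[ℂ] ℂ,
      (φ x ∈ ball c r → φ e = 1) ∧ (φ x ∉ closedBall c r → φ e = 0) := by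
  have hcont : ContinuousOn (resolvent x) (sphere c r) := fun z hz =>
    (spectrum.hasDerivAt_resolvent_const_left
      (not_not.1 fun h => hx z h hz)).continuousAt.continuousWithinAt
  -- A continuous character passes under the integral, leaving the winding number of the circle
  -- about `φ x`.
  have key : ∀ φ : R →ₐ[ℂ] ℂ,
      φ (∮ z in C(c, r), resolvent x z) = ∮ z in C(c, r), (z - φ x)⁻¹ := by
    intro φ
    have hint : CircleIntegrable (resolvent x) c r := hcont.circleIntegrable hr
    rw [circleIntegral, circleIntegral]
    have := φ.toContinuousLinearMap.intervalIntegral_comp_comm hint.out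
    rw [AlgHom.coe_toContinuousLinearMap] at this
    rw [← this]
    refine intervalIntegral.integral_congr fun θ _ => ?_
    have hu : IsUnit (algebraMap ℂ R (circleMap c r θ) - x) :=
      not_not.1 fun h => hx _ h (circleMap_mem_sphere c hr θ)
    simp only [map_smul]
    congr 1
    have h1 : φ (algebraMap ℂ R (circleMap c r θ) - x) * φ (resolvent x (circleMap c r θ)) = 1 := by
      rw [← map_mul, resolvent, Ring.mul_inverse_cancel _ hu, map_one]
    rw [map_sub, AlgHom.commutes, Algebra.algebraMap_self, RingHom.id_apply] at h1
    exact eq_inv_of_mul_eq_one_right h1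
  refine ⟨(2 * Real.pi * Complex.I : ℂ)⁻¹ • ∮ z in C(c, r), resolvent x z, fun φ => ⟨?_, ?_⟩⟩
  · intro h
    rw [map_smul, key, circleIntegral.integral_sub_inv_of_mem_ball h, smul_eq_mul,
      inv_mul_cancel₀ Complex.two_pi_I_ne_zero]
  · intro h
    have hne : ∀ z ∈ closedBall c r, z - φ x ≠ 0 := fun z hz h0 => h (sub_eq_zero.1 h0 ▸ hz)
    rw [map_smul, key,
      Complex.circleIntegral_eq_zero_of_differentiable_on_off_countable hr Set.countable_empty,
      smul_zero]
    · exact ContinuousOn.inv₀ (by fun_prop) hne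
    · exact fun z hz => DifferentiableAt.inv (by fun_prop) (hne z (ball_subset_closedBall hz.1))

/-! ### The normed unitization -/

namespace WithLp

variable (A : Type*) [NonUnitalNormedCommRing A] [NormedSpace ℂ A] [IsScalarTower ℂ A A]
  [SMulCommClass ℂ A A]

noncomputable instance unitizationNormedCommRing :
    NormedCommRing (WithLp 1 (Unitization ℂ A)) :=
  { WithLp.instUnitizationNormedRing with
    mul_comm := fun x y => WithLp.ofLp_injective 1 (mul_comm (ofLp x) (ofLp y)) }

noncomputable instance unitizationCommNormedAlgebra :
    NormedAlgebra ℂ (WithLp 1 (Unitization ℂ A)) :=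
  WithLp.instUnitizationNormedAlgebra

instance unitizationNormOneClass : NormOneClass (WithLp 1 (Unitization ℂ A)) where
  norm_one := by
    rw [unitization_norm_def]
    change ‖(1 : Unitization ℂ A).fst‖ + ‖(1 : Unitization ℂ A).snd‖ = 1
    simp

variable {A}

/-- The embedding of `A` into its `ℓ¹`-normed unitization. -/
noncomputable def unitizationInr : A →ₙₐ[ℂ] WithLp 1 (Unitization ℂ A) :=
  ((unitizationAlgEquiv (𝕜 := ℂ) (A := A) ℂ).symm : Unitization ℂ A →ₙₐ[ℂ] _).comp
    (Unitization.inrNonUnitalAlgHom ℂ A)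

theorem unitizationInr_apply (x : A) : unitizationInr x = toLp 1 (x : Unitization ℂ A) := rfl

theorem norm_unitizationInr (x : A) : ‖unitizationInr x‖ = ‖x‖ := unitization_norm_inr x

/-- The extension of a multiplicative functional to the `ℓ¹`-normed unitization. -/
noncomputable def unitizationLift (φ : A →ₙₐ[ℂ] ℂ) : WithLp 1 (Unitization ℂ A) →ₐ[ℂ] ℂ :=
  (Unitization.lift φ).comp (unitizationAlgEquiv (𝕜 := ℂ) (A := A) ℂ : _ →ₐ[ℂ] Unitization ℂ A)

theorem unitizationLift_inr (φ : A →ₙₐ[ℂ] ℂ) (x : A) :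
    unitizationLift φ (unitizationInr x) = φ x := by
  simp [unitizationLift, unitizationInr_apply, unitizationAlgEquiv]

end WithLp

open WithLp

/-- Confines the topology to the `Continuous` clause; the algebraic clause is common to both norms.
-/
theorem mem_characters_iff {A : Type*} [NonUnitalRing A] [Module ℂ A] [TopologicalSpace A]
    {g : A → ℂ} :
    g ∈ characters A ↔ Continuous g ∧ ∃ φ : A →ₙₐ[ℂ] ℂ, (∃ x, φ x ≠ 0) ∧ ⇑φ = g := by
  constructor
  · rintro ⟨f, rfl⟩
    refine ⟨map_continuous f, WeakDual.CharacterSpace.toNonUnitalAlgHom f, ?_, rfl⟩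
    by_contra! h
    exact f.2.1 (ContinuousLinearMap.ext h)
  · rintro ⟨hg, φ, ⟨x, hx⟩, rfl⟩
    exact ⟨⟨⟨(φ : A →ₗ[ℂ] ℂ), hg⟩, fun h => hx (DFunLike.congr_fun h x), map_mul φ⟩, rfl⟩

/-! ### Characters, quasi-invertibility and local units -/

section Banach

variable {A : Type*} [NonUnitalNormedCommRing A] [NormedSpace ℂ A] [IsScalarTower ℂ A A]
  [SMulCommClass ℂ A A]

/-- Let `A` be a commutative normed algebra. If every contractive multiplicative functional vanishes
at `u`, then `u` fixes no nonzero element under multiplication. -/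
theorem eq_zero_of_mul_eq_of_forall_apply_eq_zero {u v : A}
    (hu : ∀ φ : A →ₙₐ[ℂ] ℂ, (∀ x, ‖φ x‖ ≤ ‖x‖) → φ u = 0) (huv : u * v = v) : v = 0 := by
  -- Completing is what makes a non-unit of the form `1 - ι u` lie in the kernel of a character.
  let B := UniformSpace.Completion (WithLp 1 (Unitization ℂ A))
  let ι : A → B := fun x => ((unitizationInr x : WithLp 1 (Unitization ℂ A)) : B)
  have hι : ∀ x, ‖ι x‖ = ‖x‖ := fun x => by
    rw [UniformSpace.Completion.norm_coe, norm_unitizationInr]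
  have hmul : ∀ x y, ι (x * y) = ι x * ι y := fun x y => by
    simp only [ι, map_mul, UniformSpace.Completion.coe_mul]
  have : NormOneClass B := ⟨by
    rw [← UniformSpace.Completion.coe_one, UniformSpace.Completion.norm_coe, norm_one]⟩
  have hunit : IsUnit (1 - ι u) := by
    by_contra h
    obtain ⟨ψ, hψ⟩ := WeakDual.CharacterSpace.exists_apply_eq_zero h
    let φ : A →ₙₐ[ℂ] ℂ :=
      { toFun := fun x => ψ (ι x)
        map_smul' := fun k x => by
          simp only [ι, map_smul, UniformSpace.Completion.coe_smul, MonoidHom.id_apply]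
        map_zero' := by simp only [ι, map_zero, UniformSpace.Completion.coe_zero]
        map_add' := fun x y => by simp only [ι, map_add, UniformSpace.Completion.coe_add]
        map_mul' := fun x y => by rw [hmul, map_mul] }
    have := hu φ fun x => (hι x) ▸ AlgHom.norm_apply_le_self ψ (ι x)
    rw [map_sub, map_one, show ψ (ι u) = 0 from this, sub_zero] at hψ
    exact one_ne_zero hψ
  have h0 : (1 - ι u) * ι v = 0 := by rw [sub_mul, one_mul, ← hmul, huv, sub_self]
  rw [hunit.mul_right_eq_zero] at h0
  rw [← norm_eq_zero, ← hι, h0, norm_zero]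

variable [CompleteSpace A]

/-- Automatic continuity: the extension to the unitization is a character of a unital Banach
algebra. -/
theorem NonUnitalAlgHom.norm_apply_le_norm (φ : A →ₙₐ[ℂ] ℂ) (x : A) : ‖φ x‖ ≤ ‖x‖ := by
  rw [← unitizationLift_inr φ, ← norm_unitizationInr x]
  exact AlgHom.norm_apply_le_self (unitizationLift φ) (unitizationInr x)

theorem NonUnitalAlgHom.exists_characterSpace_of_apply_ne_zero (φ : A →ₙₐ[ℂ] ℂ) {x : A}
    (hx : φ x ≠ 0) : ∃ f : WeakDual.characterSpace ℂ A, ∀ y, f y = φ y := by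
  let g : WeakDual ℂ A := StrongDual.toWeakDual
    (LinearMap.mkContinuous (φ : A →ₗ[ℂ] ℂ) 1 fun x => by simpa using φ.norm_apply_le_norm x)
  have hg : ∀ y, g y = φ y := fun y => rfl
  refine ⟨⟨g, fun h => hx ?_, fun y z => ?_⟩, fun y => rfl⟩
  · rw [← hg, h]; rfl
  · rw [hg, hg, hg, map_mul]

/-- If `1 + x` is not a unit of the unitization, some character kills it; its restriction to `A`
takes the value `-1` at `x`, so it is nonzero. -/
theorem isQuasiregular_of_forall_apply_ne {x : A}
    (hx : ∀ f : WeakDual.characterSpace ℂ A, f x ≠ -1) : IsQuasiregular x := by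
  rw [isQuasiregular_iff_isUnit' ℂ]
  by_contra h
  have h' : ¬ IsUnit (1 + unitizationInr x) := fun hu =>
    h (by simpa using! hu.map (unitizationAlgEquiv (𝕜 := ℂ) (A := A) ℂ))
  obtain ⟨ψ, hψ⟩ := WeakDual.CharacterSpace.exists_apply_eq_zero h'
  rw [map_add, map_one] at hψ
  have hψx : ψ (unitizationInr x) = -1 := by linear_combination hψ
  obtain ⟨f, hf⟩ := NonUnitalAlgHom.exists_characterSpace_of_apply_ne_zero
    ((WeakDual.CharacterSpace.toNonUnitalAlgHom ψ).comp unitizationInr) (x := x)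
    (by simp [hψx])
  exact hx f (by rw [hf]; simpa using hψx)

theorem exists_characterSpace_apply_eq_of_mem_quasispectrum {x : A} {k : ℂ} (hk : k ≠ 0)
    (hx : k ∈ quasispectrum ℂ x) : ∃ f : WeakDual.characterSpace ℂ A, f x = k := by
  by_contra! h
  refine hx hk.isUnit (isQuasiregular_of_forall_apply_ne fun f hf => h f ?_)
  rw [map_neg, neg_inj, Units.smul_def, map_smul, smul_eq_mul, Units.val_inv_eq_inv_val,
    IsUnit.unit_spec, inv_mul_eq_one₀ hk] at hf
  exact hf.symm

theorem eq_zero_of_forall_characterSpace_apply_eq_zero (hss : IsSemisimpleAlgebra A) {x : A}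
    (hx : ∀ f : WeakDual.characterSpace ℂ A, f x = 0) : x = 0 := by
  have : x ∈ commJacobsonRadical A := fun a =>
    isQuasiregular_of_forall_apply_ne fun f => by simp [hx f]
  rw [hss] at this
  exact this

/-- In a regular commutative Banach algebra, if `x` has its Gelfand transform equal to `0` on one
set and close to `1` on another, then some `u` has it equal to `0`, respectively `1`, there. -/
theorem IsRegularAlgebra.exists_apply_eq_zero_and_apply_eq_one (hreg : IsRegularAlgebra A) (x : A) :
    ∃ u : A, ∀ f : WeakDual.characterSpace ℂ A,
      (f x = 0 → f u = 0) ∧ (f x ∈ closedBall 1 (1 / 2) → f u = 1) := by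
  let U := WithLp 1 (Unitization ℂ A)
  let S : Set ℂ := {0} ∪ closedBall 1 (1 / 2)
  have hS : IsClosed S := isClosed_singleton.union isClosed_closedBall
  -- The kernel of the hull on which the transform of `x` takes values in `S`.
  let I : Ideal U := ⨅ ψ : {ψ : U →ₐ[ℂ] ℂ // ψ (unitizationInr x) ∈ S}, RingHom.ker ψ.1
  have hI : ∀ a, a ∈ I ↔ ∀ ψ : U →ₐ[ℂ] ℂ, ψ (unitizationInr x) ∈ S → ψ a = 0 := fun a => by
    simp [I, Submodule.mem_iInf, RingHom.mem_ker]
  have hIc : IsClosed (I : Set U) := by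
    have : (I : Set U) = ⋂ ψ : {ψ : U →ₐ[ℂ] ℂ // ψ (unitizationInr x) ∈ S}, {a | ψ.1 a = 0} := by
      ext a
      simp [hI]
    rw [this]
    exact isClosed_iInter fun ψ => isClosed_eq (map_continuous ψ.1) continuous_const
  -- Passing to the quotient adds no characters outside that hull: regularity would give an element
  -- of `I` on which such a character is nonzero.
  have hspec : ∀ χ : (U ⧸ I) →ₐ[ℂ] ℂ, χ (Ideal.Quotient.mk I (unitizationInr x)) ∈ S := by
    intro χ
    by_contra hχ
    let ψ : U →ₐ[ℂ] ℂ := χ.comp (Ideal.Quotient.mkₐ ℂ I)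
    have hψ : ∀ a ∈ I, ψ a = 0 := fun a ha => by
      change χ (Ideal.Quotient.mk I a) = 0
      rw [Ideal.Quotient.eq_zero_iff_mem.2 ha, map_zero]
    have hψx : ψ (unitizationInr x) ∉ S := hχ
    obtain ⟨f, hf⟩ := NonUnitalAlgHom.exists_characterSpace_of_apply_ne_zero
      ((ψ : U →ₙₐ[ℂ] ℂ).comp unitizationInr) (x := x) (fun h => hψx (Or.inl h))
    have hFc : IsClosed {g : WeakDual.characterSpace ℂ A | g x ∈ S} :=
      hS.preimage ((WeakDual.eval_continuous x).comp continuous_subtype_val)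
    obtain ⟨y, hy, hfy⟩ := hreg _ hFc f (by
      change f x ∉ S
      rw [hf]; exact hψx)
    refine hfy ?_
    rw [hf]
    refine hψ _ ((hI _).2 fun θ hθ => ?_)
    by_contra hne
    obtain ⟨g, hg⟩ := NonUnitalAlgHom.exists_characterSpace_of_apply_ne_zero
      ((θ : U →ₙₐ[ℂ] ℂ).comp unitizationInr) (x := y) hne
    refine hne ?_
    have := hy g (by change g x ∈ S; rw [hg]; exact hθ)
    rwa [hg] at this
  -- Any radius strictly between `1 / 2` and `1` separates the two pieces of `S`.
  obtain ⟨e, he⟩ := exists_forall_algHom_apply_eq_indicator (R := U ⧸ I)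
    (x := Ideal.Quotient.mk I (unitizationInr x)) (c := 1) (r := 3 / 4) (by norm_num) (by
      intro z hz hz'
      obtain ⟨χ, rfl⟩ := WeakDual.CharacterSpace.mem_spectrum_iff_exists.1 hz
      rcases hspec (WeakDual.CharacterSpace.toAlgHom χ) with h | h
      · rw [Set.mem_singleton_iff] at h
        change χ _ = 0 at h
        rw [h] at hz'
        norm_num at hz'
      · rw [mem_closedBall] at h
        change dist (χ _) 1 ≤ _ at h
        rw [mem_sphere] at hz'
        linarith)
  obtain ⟨a, rfl⟩ := Ideal.Quotient.mk_surjective e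
  have ha : ∀ ψ : U →ₐ[ℂ] ℂ, (ψ (unitizationInr x) = 0 → ψ a = 0) ∧
      (ψ (unitizationInr x) ∈ closedBall 1 (1 / 2) → ψ a = 1) := by
    intro ψ
    have lift : ψ (unitizationInr x) ∈ S → ∃ χ : (U ⧸ I) →ₐ[ℂ] ℂ,
        ∀ b, χ (Ideal.Quotient.mk I b) = ψ b := fun h =>
      ⟨Ideal.Quotient.liftₐ I ψ fun b hb => (hI b).1 hb ψ h, fun b => rfl⟩
    constructor
    · intro h
      obtain ⟨χ, hχ⟩ := lift (Or.inl h)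
      rw [← hχ]
      refine (he χ).2 ?_
      rw [hχ, h]
      norm_num
    · intro h
      obtain ⟨χ, hχ⟩ := lift (Or.inr h)
      rw [← hχ]
      refine (he χ).1 ?_
      rw [hχ]
      exact closedBall_subset_ball (by norm_num) h
  let fst : U →ₐ[ℂ] ℂ := (Unitization.fstHom ℂ A).comp
    (unitizationAlgEquiv (𝕜 := ℂ) (A := A) ℂ : U →ₐ[ℂ] Unitization ℂ A)
  -- The character with kernel `A` sends `x` to `0`, hence also `a`, so `a` lies in `A`.
  have ha0 : (ofLp a).fst = 0 := (ha fst).1 rfl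
  have hau : unitizationInr (ofLp a).snd = a :=
    WithLp.ofLp_injective 1 (Unitization.ext ha0.symm rfl)
  refine ⟨(ofLp a).snd, fun f => ?_⟩
  have := ha (unitizationLift (WeakDual.CharacterSpace.toNonUnitalAlgHom f))
  rw [← hau] at this
  have hf := unitizationLift_inr (WeakDual.CharacterSpace.toNonUnitalAlgHom f)
  exact ⟨fun h => (hf _).symm.trans (this.1 ((hf x).trans h)),
    fun h => (hf _).symm.trans (this.2 ((congrArg (· ∈ closedBall 1 (1 / 2)) (hf x)).mpr h))⟩

end Banach

/-! ### Arbitrary algebra norms -/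

namespace NonUnitalAlgebraNorm

variable {A : Type*}

/-- The normed ring structure on `A` given by an algebra norm. -/
@[reducible]
def toNonUnitalNormedCommRing [NonUnitalCommRing A] [Module ℂ A] (N : NonUnitalAlgebraNorm A) :
    NonUnitalNormedCommRing A :=
  { ‹NonUnitalCommRing A›, AddGroupNorm.toNormedAddCommGroup N.toAddGroupNorm with
    norm_mul_le := N.mul_le' }

theorem eq_zero_of_mul_eq_of_forall_apply_eq_zero [NonUnitalCommRing A] [Module ℂ A]
    [IsScalarTower ℂ A A] [SMulCommClass ℂ A A] (N : NonUnitalAlgebraNorm A) {u v : A}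
    (hu : ∀ φ : A →ₙₐ[ℂ] ℂ, (∀ x, ‖φ x‖ ≤ N x) → φ u = 0) (huv : u * v = v) : v = 0 := by
  let := N.toNonUnitalNormedCommRing
  let : NormedSpace ℂ A := { norm_smul_le := fun k x => (N.smul' k x).le }
  exact _root_.eq_zero_of_mul_eq_of_forall_apply_eq_zero hu huv

theorem continuous_of_forall_norm_le [NonUnitalRing A] [Module ℂ A] (N : NonUnitalAlgebraNorm A)
    (φ : A →ₙₐ[ℂ] ℂ) (hφ : ∀ x, ‖φ x‖ ≤ N x) : @Continuous _ _ N.topology _ φ := by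
  let := AddGroupNorm.toNormedAddCommGroup N.toAddGroupNorm
  exact AddMonoidHomClass.continuous_of_bound φ 1 fun x => (hφ x).trans_eq (one_mul _).symm

/-- An algebra norm is a Q-algebra norm once its open unit ball consists of quasi-invertible
elements. -/
theorem isQAlgebraNorm_of_forall_lt_one [NonUnitalRing A] [Module ℂ A] (N : NonUnitalAlgebraNorm A)
    (h : ∀ x, N x < 1 → IsQuasiregular x) : N.IsQAlgebraNorm := by
  let := AddGroupNorm.toNormedAddCommGroup N.toAddGroupNorm
  refine Metric.isOpen_iff.2 fun x hx => ?_
  obtain ⟨x', -, hx'⟩ := isQuasiregular_iff.1 hx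
  have hpos : 0 < 1 + N x' := add_pos_of_pos_of_nonneg one_pos (apply_nonneg N.toSeminorm x')
  refine ⟨(1 + N x')⁻¹, inv_pos.2 hpos, fun y hy => ?_⟩
  rw [mem_ball, dist_eq_norm] at hy
  have hy' : N (y - x) < (1 + N x')⁻¹ := hy
  -- In the unitization `1 + x'` inverts `1 + x`, so this `z` solves `1 + y = (1 + z) * (1 + x)`;
  -- the radius is chosen to force `N z < 1`.
  let z := (y - x) + (y - x) * x'
  have hz : IsQuasiregular z := by
    refine h z (lt_of_le_of_lt ?_ ((lt_inv_mul_iff₀' hpos).1 (by simpa using hy')))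
    calc N z ≤ N (y - x) + N ((y - x) * x') := N.add_le' _ _
      _ ≤ N (y - x) + N (y - x) * N x' := add_le_add_right (N.mul_le' _ _) _
      _ = N (y - x) * (1 + N x') := by ring
  have hyz : y = x + z + z * x := by
    have : x + z + z * x = y + (y - x) * (x + x' + x' * x) := by
      simp only [z, add_mul, mul_add, mul_assoc]
      abel
    rw [this, hx', mul_zero, add_zero]
  rw [Set.mem_ofPred_eq, isQuasiregular_iff'] at hx ⊢
  rw [isQuasiregular_iff'] at hz
  convert hz.mul hx using 1
  exact congrArg PreQuasiregular.equiv hyz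

variable [NonUnitalNormedCommRing A] [NormedSpace ℂ A] [IsScalarTower ℂ A A] [SMulCommClass ℂ A A]
  [CompleteSpace A]

/-- Every character of a regular semisimple commutative Banach algebra is bounded by every algebra
norm. -/
theorem norm_characterSpace_apply_le (hreg : IsRegularAlgebra A) (hss : IsSemisimpleAlgebra A)
    (N : NonUnitalAlgebraNorm A) (f : WeakDual.characterSpace ℂ A) (x : A) : ‖f x‖ ≤ N x := by
  have eval : ∀ a : A, Continuous fun g : WeakDual.characterSpace ℂ A => g a := fun a =>
    (WeakDual.eval_continuous a).comp continuous_subtype_val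
  suffices hf : f ∈ {g : WeakDual.characterSpace ℂ A | ∀ y, ‖g y‖ ≤ N y} from hf x
  by_contra hf
  have hE : IsClosed {g : WeakDual.characterSpace ℂ A | ∀ y, ‖g y‖ ≤ N y} := by
    rw [Set.ofPred_forall]
    exact isClosed_iInter fun y => isClosed_le (eval y).norm continuous_const
  obtain ⟨a, haE, hfa⟩ := hreg _ hE f hf
  obtain ⟨u, hu⟩ := hreg.exists_apply_eq_zero_and_apply_eq_one ((f a)⁻¹ • a)
  obtain ⟨v, hv, hfv⟩ := hreg {g | g ((f a)⁻¹ • a) ∉ ball 1 (1 / 2)}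
    (isOpen_ball.isClosed_compl.preimage (eval _)) f (by simp [hfa])
  have huv : u * v = v := by
    rw [← sub_eq_zero]
    refine eq_zero_of_forall_characterSpace_apply_eq_zero hss fun g => ?_
    rw [map_sub, map_mul]
    by_cases hg : g ((f a)⁻¹ • a) ∈ ball 1 (1 / 2)
    · rw [(hu g).2 (ball_subset_closedBall hg), one_mul, sub_self]
    · rw [hv g hg, mul_zero, sub_zero]
  refine hfv ?_
  -- An `N`-contractive functional with `φ u ≠ 0` would be a character in the closed set above,
  -- where `a` and hence `u` vanish.
  rw [N.eq_zero_of_mul_eq_of_forall_apply_eq_zero (u := u) (fun φ hφ => ?_) huv, map_zero]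
  by_contra hne
  obtain ⟨g, hg⟩ := φ.exists_characterSpace_of_apply_ne_zero hne
  refine hne ?_
  rw [← hg]
  refine (hu g).1 ?_
  rw [map_smul, haE g fun y => by rw [hg]; exact hφ y, smul_zero]

theorem isQuasiregular_of_lt_one (hreg : IsRegularAlgebra A) (hss : IsSemisimpleAlgebra A)
    (N : NonUnitalAlgebraNorm A) {x : A} (hx : N x < 1) : IsQuasiregular x :=
  isQuasiregular_of_forall_apply_ne fun f hf => by
    have := N.norm_characterSpace_apply_le hreg hss f x
    rw [hf, norm_neg, norm_one] at this
    exact this.not_gt hx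

theorem isQAlgebraNorm (hreg : IsRegularAlgebra A) (hss : IsSemisimpleAlgebra A)
    (N : NonUnitalAlgebraNorm A) : N.IsQAlgebraNorm :=
  N.isQAlgebraNorm_of_forall_lt_one fun _ => N.isQuasiregular_of_lt_one hreg hss

theorem characters_eq (hreg : IsRegularAlgebra A) (hss : IsSemisimpleAlgebra A)
    (N : NonUnitalAlgebraNorm A) : N.characters = _root_.characters A := by
  ext g
  rw [NonUnitalAlgebraNorm.characters, @mem_characters_iff A _ _ N.topology, mem_characters_iff]
  constructor
  · rintro ⟨-, φ, hφ, rfl⟩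
    exact ⟨AddMonoidHomClass.continuous_of_bound φ 1 fun x => by simpa using φ.norm_apply_le_norm x,
      φ, hφ, rfl⟩
  · rintro ⟨-, φ, ⟨x, hx⟩, rfl⟩
    refine ⟨N.continuous_of_forall_norm_le φ fun y => ?_, φ, ⟨x, hx⟩, rfl⟩
    obtain ⟨f, hf⟩ := φ.exists_characterSpace_of_apply_ne_zero hx
    rw [← hf]
    exact N.norm_characterSpace_apply_le hreg hss f y

theorem nonUnitalSpectralRadius_le (hreg : IsRegularAlgebra A) (hss : IsSemisimpleAlgebra A)
    (N : NonUnitalAlgebraNorm A) (x : A) : nonUnitalSpectralRadius x ≤ ENNReal.ofReal (N x) := by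
  refine iSup₂_le fun k hk => ?_
  rcases eq_or_ne k 0 with rfl | hk0
  · simp
  obtain ⟨f, rfl⟩ := exists_characterSpace_apply_eq_of_mem_quasispectrum hk0 hk
  rw [← enorm_eq_nnnorm, ← ofReal_norm]
  exact ENNReal.ofReal_le_ofReal (N.norm_characterSpace_apply_le hreg hss f x)

end NonUnitalAlgebraNorm

theorem theorem2p8 (A : Type*) [NonUnitalNormedCommRing A] [NormedSpace ℂ A]
    [IsScalarTower ℂ A A] [SMulCommClass ℂ A A] [CompleteSpace A]
    (hreg : IsRegularAlgebra A) (hss : IsSemisimpleAlgebra A)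
    (N : NonUnitalAlgebraNorm A) :
    N.IsQAlgebraNorm ∧
      N.characters = characters A ∧
      ∀ x : A, nonUnitalSpectralRadius x ≤ ENNReal.ofReal (N x) := by
  exact ⟨N.isQAlgebraNorm hreg hss, N.characters_eq hreg hss, N.nonUnitalSpectralRadius_le hreg hss⟩
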